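/- Throughout, "smooth" means $C^1$-smooth, a convex body in $\mathbb R^2$ is a compact convex set with non-empty interior, and it is strictly convex if its boundary contains no line segment. A symmetric billiard configuration is a pair $(K,T)$ of smooth, strictly convex bodies $K\subset\mathbb R^2_q$, $T\subset\mathbb R^2_p$ with $K=-K$ and $T=-T$. Let $n_K$, $n_T$ be the unit outer normals of $K$ and $T$. A $(K,T)$-billiard trajectory is given by a sequence $(q_i,p_i)_{i\in\mathbb Z}$ in $\partial K\times\partial T$ such that, for every $i$, $q_{i+1}=q_i-t_i\,n_T(p_i)$ and $p_{i+1}=p_i+s_i\,n_K(q_{i+1})$ for some $t_i,s_i>0$. The polygonal line $(q_i)$ is called a $T$-billiard trajectory in $K$, and $(p_i)$ is called the dual $K$-billiard trajectory in $T$; the $K$-billiard trajectories in $T$ are the sequences $(p_i)$ that arise in this way. A line is tangent to a convex set $C$ if it meets $C$ and $C$ lies in one of the two closed half-planes that it bounds; a trajectory is tangent to $C$ if the line through each of its segments is tangent to $C$. A convex $T$-caustic in $K$ is a non-empty compact convex set $C\subset K$ such that every $T$-billiard trajectory in $K$, once one of its segments is (on a line) tangent to $C$, stays tangent to $C$ after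 every later reflection at $\partial K$; convex $K$-caustics in $T$ are defined in the same way with the roles of $K$ and $T$ exchanged. A convex $T$-caustic $C$ in $K$ and a convex $K$-caustic $C'$ in $T$ are dual if, for every $(K,T)$-billiard trajectory $(q_i,p_i)_{i\in\mathbb Z}$, the $T$-billiard trajectory $(q_i)$ is tangent to $C$ if and only if the dual $K$-billiard trajectory $(p_i)$ is tangent to $C'$. **Theorem.** There exist a symmetric billiard configuration $(K,T)$ and a smooth, strictly convex body $C$, contained in the interior of $K$, such that $C$ is a convex $T$-caustic in $K$ and there is no convex $K$-caustic in $T$ that is dual to $C$. -/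

import Mathlib

namespace MinkowskiBilliard

/-- The Euclidean plane; it serves both as the position plane and as the momentum plane. -/
abbrev Plane : Type := EuclideanSpace ℝ (Fin 2)

/-- `K` has `C¹`-smooth boundary: near each boundary point, `K` is a sublevel set of a `C¹`
function whose derivative does not vanish at that point. -/
def HasC1Boundary (K : Set Plane) : Prop :=
  ∀ x ∈ frontier K, ∃ U : Set Plane, IsOpen U ∧ x ∈ U ∧ ∃ f : Plane → ℝ,
    ContDiffOn ℝ 1 f U ∧ fderiv ℝ f x ≠ 0 ∧ ∀ y ∈ U, (y ∈ K ↔ f y ≤ 0)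

/-- A `C¹`-smooth, strictly convex planar convex body (compact, convex, non-empty interior). -/
structure IsSmoothStrictlyConvexBody (K : Set Plane) : Prop where
  isCompact : IsCompact K
  strictConvex : StrictConvex ℝ K
  interior_nonempty : (interior K).Nonempty
  hasC1Boundary : HasC1Boundary K

/-- A symmetric billiard configuration: a pair of `C¹`-smooth, strictly convex planar convex
bodies, each of them symmetric about the origin. -/
structure IsSymmetricBilliardConfiguration (K T : Set Plane) : Prop where
  left_body : IsSmoothStrictlyConvexBody K
  right_body : IsSmoothStrictlyConvexBody T
  left_symm : ∀ x ∈ K, -x ∈ K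
  right_symm : ∀ x ∈ T, -x ∈ T

/-- `u` is the unit outer normal of the convex set `K` at the boundary point `x`. (For a body with
`C¹` boundary there is exactly one such `u` at each boundary point.) -/
def IsOuterUnitNormal (K : Set Plane) (x u : Plane) : Prop :=
  x ∈ frontier K ∧ ‖u‖ = 1 ∧ ∀ y ∈ K, inner ℝ u y ≤ inner ℝ u x

/-- A `(K,T)`-billiard trajectory, given by its successive bouncing points: from `(q i, p i)` one
moves in `K` along the inner normal of `T` at `p i` until the boundary of `K` is hit, at `q (i+1)`,
and then one moves in `T` along the outer normal of `K` at `q (i+1)` until the boundary of `T`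
is hit, at `p (i+1)`. The polygonal line through the `q i` is the corresponding `T`-billiard
trajectory in `K`, and the one through the `p i` is the dual `K`-billiard trajectory in `T`. -/
structure IsBilliardTrajectory (K T : Set Plane) (q p : ℤ → Plane) : Prop where
  q_mem : ∀ i, q i ∈ frontier K
  p_mem : ∀ i, p i ∈ frontier T
  q_step : ∀ i, ∃ u, IsOuterUnitNormal T (p i) u ∧ ∃ t : ℝ, 0 < t ∧ q (i + 1) = q i - t • u
  p_step : ∀ i, ∃ u, IsOuterUnitNormal K (q (i + 1)) u ∧
    ∃ t : ℝ, 0 < t ∧ p (i + 1) = p i + t • u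

/-- The determinant of a pair of vectors of the plane. -/
def det (v w : Plane) : ℝ := v 0 * w 1 - v 1 * w 0

/-- The oriented line through `x` with direction `v` is positively tangent to `C`: it meets `C`,
and `C` is contained in the closed half-plane to its left. -/
def IsPositivelyTangent (C : Set Plane) (x v : Plane) : Prop :=
  (∃ t : ℝ, x + t • v ∈ C) ∧ ∀ y ∈ C, 0 ≤ det v (y - x)

/-- The line through `x` and `y` is tangent to `C`, positively or negatively. -/
def IsTangentLine (C : Set Plane) (x y : Plane) : Prop :=
  IsPositivelyTangent C x (y - x) ∨ IsPositivelyTangent C x (-(y - x))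

/-- All the (lines spanned by the) segments of the polygonal line `x` are tangent to `C`. -/
def IsTangentTrajectory (C : Set Plane) (x : ℤ → Plane) : Prop :=
  ∀ i, IsTangentLine C (x i) (x (i + 1))

/-- `C` is a convex `T`-caustic in `K`: a non-empty compact convex subset of `K` (segments and
points are allowed) such that every `T`-billiard trajectory in `K`, once tangent to `C`, stays
tangent to `C` after every reflection. -/
structure IsConvexCaustic (K T C : Set Plane) : Prop where
  nonempty : C.Nonempty
  isCompact : IsCompact C
  convex : Convex ℝ C
  subset : C ⊆ K
  stays_tangent : ∀ q p : ℤ → Plane, IsBilliardTrajectory K T q p →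
    ∀ i, IsTangentLine C (q i) (q (i + 1)) → ∀ j, i ≤ j → IsTangentLine C (q j) (q (j + 1))

/-- Duality of a convex `T`-caustic `C` in `K` and a convex `K`-caustic `C'` in `T`: a
`T`-billiard trajectory in `K` is tangent to `C` if and only if the dual `K`-billiard trajectory
in `T` is tangent to `C'`. -/
def AreDualCaustics (K T C C' : Set Plane) : Prop :=
  ∀ q p : ℤ → Plane, IsBilliardTrajectory K T q p →
    (IsTangentTrajectory C q ↔ IsTangentTrajectory C' p)

/-- The roles of the two bodies are interchangeable: the `K`-billiard trajectories in `T`, i.e. the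
momentum components of `(K,T)`-billiard trajectories, are the position components of
`(T,K)`-billiard trajectories. -/
theorem IsBilliardTrajectory.swap {K T : Set Plane} (hK : ∀ x ∈ K, -x ∈ K) {q p : ℤ → Plane}
    (h : IsBilliardTrajectory K T q p) :
    IsBilliardTrajectory T K p (fun i => -q (i + 1)) := by
  have hneg : -K = K := by
    ext x
    exact ⟨fun hx => by simpa using hK _ hx, fun hx => by simpa using hK _ hx⟩
  have hfr : ∀ x ∈ frontier K, -x ∈ frontier K := by
    intro x hx
    have h2 : (Homeomorph.neg Plane) ⁻¹' (frontier K) = frontier K := by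
      rw [(Homeomorph.neg Plane).preimage_frontier]
      congr 1
    rw [← h2] at hx
    exact hx
  refine ⟨h.p_mem, fun i => hfr _ (h.q_mem _), fun i => ?_, fun i => ?_⟩
  · obtain ⟨u, ⟨hu1, hu2, hu3⟩, t, ht, he⟩ := h.p_step i
    refine ⟨-u, ⟨hfr _ hu1, by simpa using hu2, fun y hy => ?_⟩, t, ht, by simpa using he⟩
    have := hu3 _ (hK y hy)
    simpa using this
  · obtain ⟨u, hu, t, ht, he⟩ := h.q_step (i + 1)
    refine ⟨u, hu, t, ht, ?_⟩
    rw [he]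
    abel

end MinkowskiBilliard

namespace MinkowskiBilliard

open Real

/-! Take for `K` the unit disc, for `C` the concentric disc of radius `sin a`, and for `T` the body
with support function `h θ = 1 + ε cos (4 θ)`, `ε = 1/40`. A chord tangent to `C` that arrives at
`dir θ` has momentum `pt (θ + a + π) = -pt (θ + a)`, and the chord leaving symmetrically has
momentum `pt (θ - a)`. The reflection law asks that their difference `pt (θ + a) + pt (θ - a)` be a
positive multiple of `dir θ`. Its component normal to `dir θ` is proportional to `sin (4 θ) * (4 cos
(4 a) cos a + sin (4 a) sin a)`, which vanishes for all `θ` exactly when the second factor does;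
`sin a ^ 2 = 1/6` is a solution. So `C` is a caustic (`det_dir_pt`, `pt_add_pt`, `tangent_step`).
Central symmetry needs an even frequency, and frequency 2 fails: there the factor is `2 cos a ^ 3`.

The dual segment in `T` at the bounce `dir θ` has direction `dir θ` and lies at distance `g θ = sin
a * (1 - 9 ε cos (4 θ))` from the origin. A dual caustic would have to touch all these lines, hence
have `g` as its support function up to a quarter turn. But `g + g''` is a positive multiple of `1 +
135 ε cos (4 θ)`, which changes sign, so no convex set has this support function; meanwhile `h + h''
= 1 - 15 ε cos (4 θ)` stays positive, so `T` is a genuine smooth body. The contradiction is made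
finite by comparing `g` in the directions `0`, `π/4`, `π/2` (`strip_of_areDualCaustics`,
`not_areDualCaustics`). -/

theorem inner_eq (x y : Plane) : inner ℝ x y = x 0 * y 0 + x 1 * y 1 := by
  simp [PiLp.inner_apply, Fin.sum_univ_two, mul_comm]

theorem norm_sq_eq (x : Plane) : ‖x‖ ^ 2 = x 0 ^ 2 + x 1 ^ 2 := by
  rw [EuclideanSpace.real_norm_sq_eq, Fin.sum_univ_two]

theorem plane_ext {x y : Plane} (h0 : x 0 = y 0) (h1 : x 1 = y 1) : x = y := by
  ext i
  fin_cases i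
  · exact h0
  · exact h1

/-! ### Discs -/

theorem isSmoothStrictlyConvexBody_closedBall {r : ℝ} (hr : 0 < r) :
    IsSmoothStrictlyConvexBody (Metric.closedBall (0 : Plane) r) where
  isCompact := isCompact_closedBall 0 r
  strictConvex := strictConvex_closedBall ℝ 0 r
  interior_nonempty := by
    rw [interior_closedBall _ hr.ne']
    exact Metric.nonempty_ball.2 hr
  hasC1Boundary := by
    intro x hx
    rw [frontier_closedBall _ hr.ne'] at hx
    have hx' : ‖x‖ = r := by simpa using hx
    refine ⟨Set.univ, isOpen_univ, Set.mem_univ _, fun y => ‖y‖ ^ 2 - r ^ 2, ?_, ?_, ?_⟩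
    · exact ((contDiff_norm_sq ℝ).sub contDiff_const).contDiffOn
    · intro h
      have hd : HasFDerivAt (fun y : Plane => ‖y‖ ^ 2 - r ^ 2) (2 • innerSL ℝ x) x :=
        (hasStrictFDerivAt_norm_sq x).hasFDerivAt.sub_const _
      rw [hd.fderiv] at h
      have h2 := congrArg (fun L => L x) h
      have h3 : 2 * ‖x‖ ^ 2 = 0 := by simpa using h2
      rw [hx'] at h3
      have := pow_pos hr 2
      linarith
    · intro y _
      rw [mem_closedBall_zero_iff, sub_nonpos]
      exact (pow_le_pow_iff_left₀ (norm_nonneg _) hr.le two_ne_zero).symm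

theorem IsOuterUnitNormal.eq_of_closedBall {x u : Plane}
    (h : IsOuterUnitNormal (Metric.closedBall (0 : Plane) 1) x u) : u = x := by
  obtain ⟨h1, h2, h3⟩ := h
  rw [frontier_closedBall _ one_ne_zero] at h1
  have h1' : ‖x‖ = 1 := by simpa using h1
  have h4 := h3 u (by simp [h2])
  rw [real_inner_self_eq_norm_sq, h2] at h4
  refine (inner_eq_one_iff_of_norm_eq_one (𝕜 := ℝ) h2 h1').1 (le_antisymm ?_ (by linarith))
  have := real_inner_le_norm u x
  rw [h1', h2] at this
  linarith

theorem isOuterUnitNormal_closedBall {x : Plane} (hx : ‖x‖ = 1) :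
    IsOuterUnitNormal (Metric.closedBall (0 : Plane) 1) x x := by
  refine ⟨?_, hx, fun y hy => ?_⟩
  · rw [frontier_closedBall _ one_ne_zero]
    simpa using hx
  · have := real_inner_le_norm x y
    have hy' : ‖y‖ ≤ 1 := by simpa using hy
    rw [real_inner_self_eq_norm_sq, hx]
    rw [hx] at this
    linarith

/-- The unit vector of angle `θ`. -/
noncomputable def dir (θ : ℝ) : Plane := !₂[cos θ, sin θ]

@[simp] theorem dir_zero (θ : ℝ) : dir θ 0 = cos θ := rfl
@[simp] theorem dir_one (θ : ℝ) : dir θ 1 = sin θ := rfl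

theorem norm_dir (θ : ℝ) : ‖dir θ‖ = 1 := by
  have h := norm_sq_eq (dir θ)
  rw [dir_zero, dir_one, cos_sq_add_sin_sq] at h
  nlinarith [norm_nonneg (dir θ)]

theorem dir_add_pi (θ : ℝ) : dir (θ + π) = -dir θ := by
  apply plane_ext <;> simp

theorem exists_dir {u : Plane} (hu : ‖u‖ = 1) : ∃ θ, u = dir θ := by
  have h := norm_sq_eq u
  rw [hu] at h
  have hz : ‖(⟨u 0, u 1⟩ : ℂ)‖ = 1 := by
    rw [Complex.norm_eq_sqrt_sq_add_sq, ← h]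
    simp
  refine ⟨Complex.arg ⟨u 0, u 1⟩, plane_ext ?_ ?_⟩
  · have := Complex.norm_mul_cos_arg ⟨u 0, u 1⟩
    rw [hz, one_mul] at this
    exact this.symm
  · have := Complex.norm_mul_sin_arg ⟨u 0, u 1⟩
    rw [hz, one_mul] at this
    exact this.symm

theorem det_dir_self_sq_le (θ : ℝ) (y : Plane) : det (dir θ) y ^ 2 ≤ ‖y‖ ^ 2 := by
  rw [norm_sq_eq]
  simp only [det, dir_zero, dir_one]
  nlinarith [sq_nonneg (cos θ * y 0 + sin θ * y 1), cos_sq_add_sin_sq θ]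

theorem isPositivelyTangent_closedBall_iff {r : ℝ} (hr : 0 ≤ r) (x : Plane) (θ : ℝ) {t : ℝ}
    (ht : 0 < t) :
    IsPositivelyTangent (Metric.closedBall (0 : Plane) r) x (t • dir θ) ↔
      det (dir θ) x = -r := by
  have hcs := cos_sq_add_sin_sq θ
  constructor
  · rintro ⟨⟨c, hc⟩, h⟩
    apply le_antisymm
    -- The point of the disc furthest to the right of the direction `dir θ` gives the sharp
    -- inequality.
    · have hm : r • !₂[sin θ, -cos θ] ∈ Metric.closedBall (0 : Plane) r := by
        rw [mem_closedBall_zero_iff, norm_smul, Real.norm_of_nonneg hr]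
        have : ‖(!₂[sin θ, -cos θ] : Plane)‖ ^ 2 = 1 := by
          rw [norm_sq_eq]; simp
        have : ‖(!₂[sin θ, -cos θ] : Plane)‖ = 1 := by
          nlinarith [norm_nonneg (!₂[sin θ, -cos θ] : Plane)]
        rw [this, mul_one]
      have := h _ hm
      simp only [det, PiLp.smul_apply, smul_eq_mul, dir_zero, dir_one, PiLp.sub_apply,
        Matrix.cons_val_zero, Matrix.cons_val_one] at this ⊢
      have h2 : 0 ≤ t * (-r - (cos θ * x 1 - sin θ * x 0)) := by
        linear_combination this - t * r * hcs
      have := nonneg_of_mul_nonneg_right h2 ht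
      linarith
    · have h1 := det_dir_self_sq_le θ (x + c • t • dir θ)
      have h2 : det (dir θ) (x + c • t • dir θ) = det (dir θ) x := by
        simp only [det, PiLp.smul_apply, smul_eq_mul, dir_zero, dir_one, PiLp.add_apply]
        ring
      rw [mem_closedBall_zero_iff] at hc
      rw [h2] at h1
      exact (abs_le.1 (abs_le_of_sq_le_sq (h1.trans (pow_le_pow_left₀ (norm_nonneg _) hc 2)) hr)).1
  · intro h
    constructor
    · refine ⟨-(inner ℝ (dir θ) x) / t, ?_⟩
      rw [mem_closedBall_zero_iff, smul_smul, div_mul_cancel₀ _ ht.ne']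
      refine abs_le_of_sq_le_sq' ?_ hr |>.2
      rw [norm_sq_eq]
      simp only [det, inner_eq, PiLp.smul_apply, smul_eq_mul, dir_zero, dir_one,
        PiLp.add_apply] at h ⊢
      apply le_of_eq
      have e0 : x 0 + -(cos θ * x 0 + sin θ * x 1) * cos θ = -sin θ * (cos θ * x 1 - sin θ * x 0) := by
        linear_combination -x 0 * hcs
      have e1 : x 1 + -(cos θ * x 0 + sin θ * x 1) * sin θ = cos θ * (cos θ * x 1 - sin θ * x 0) := by
        linear_combination -x 1 * hcs
      rw [e0, e1, h]
      linear_combination r ^ 2 * hcs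
    · intro y hy
      have h1 := det_dir_self_sq_le θ y
      rw [mem_closedBall_zero_iff] at hy
      have h2 := (abs_le.1 (abs_le_of_sq_le_sq
        (h1.trans (pow_le_pow_left₀ (norm_nonneg _) hy 2)) hr)).1
      have h3 : det (t • dir θ) (y - x) = t * (det (dir θ) y - det (dir θ) x) := by
        simp only [det, PiLp.smul_apply, smul_eq_mul, PiLp.sub_apply]
        ring
      rw [h3]
      exact mul_nonneg ht.le (by linarith)

/-- `det (dir θ) x` is the signed distance from the origin to the line; squaring absorbs the two
orientations. -/
theorem isTangentLine_closedBall_iff {r : ℝ} (hr : 0 ≤ r) {x y : Plane} {θ t : ℝ}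
    (ht : 0 < t) (hy : y = x - t • dir θ) :
    IsTangentLine (Metric.closedBall (0 : Plane) r) x y ↔ det (dir θ) x ^ 2 = r ^ 2 := by
  have e1 : y - x = t • dir (θ + π) := by rw [hy, dir_add_pi, smul_neg]; abel
  have e2 : -(y - x) = t • dir θ := by rw [hy]; abel
  have e3 : det (dir (θ + π)) x = -det (dir θ) x := by
    rw [dir_add_pi]
    simp only [det, PiLp.neg_apply]
    ring
  rw [IsTangentLine, e2, e1, isPositivelyTangent_closedBall_iff hr _ _ ht,
    isPositivelyTangent_closedBall_iff hr _ _ ht, e3, neg_inj, sq_eq_sq_iff_eq_or_eq_neg]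

/-! ### The body with support function `1 + cos (4 θ) / 40` -/

/-- The support function of the momentum body, as a function of the angle of the normal. -/
noncomputable def supp (θ : ℝ) : ℝ := 1 + cos (4 * θ) / 40

/-- The derivative of the support function. -/
noncomputable def suppDeriv (θ : ℝ) : ℝ := -sin (4 * θ) / 10

/-- The boundary point of the momentum body at which `dir θ` is normal. -/
noncomputable def pt (θ : ℝ) : Plane :=
  !₂[supp θ * cos θ - suppDeriv θ * sin θ, supp θ * sin θ + suppDeriv θ * cos θ]

/-- The momentum body. -/
def momentumBody : Set Plane := {x | ∀ θ, inner ℝ (dir θ) x ≤ supp θ}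

@[simp] theorem pt_zero (θ : ℝ) : pt θ 0 = supp θ * cos θ - suppDeriv θ * sin θ := rfl
@[simp] theorem pt_one (θ : ℝ) : pt θ 1 = supp θ * sin θ + suppDeriv θ * cos θ := rfl

theorem supp_pos (θ : ℝ) : 9 / 10 < supp θ := by
  have := neg_one_le_cos (4 * θ)
  unfold supp
  linarith

theorem supp_add_pi (θ : ℝ) : supp (θ + π) = supp θ := by
  have : 4 * (θ + π) = 4 * θ + 2 * π + 2 * π := by ring
  rw [supp, supp, this, cos_add_two_pi, cos_add_two_pi]

theorem suppDeriv_add_pi (θ : ℝ) : suppDeriv (θ + π) = suppDeriv θ := by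
  have : 4 * (θ + π) = 4 * θ + 2 * π + 2 * π := by ring
  rw [suppDeriv, suppDeriv, this, sin_add_two_pi, sin_add_two_pi]

theorem pt_add_pi (θ : ℝ) : pt (θ + π) = -pt θ := by
  apply plane_ext <;> simp [supp_add_pi, suppDeriv_add_pi] <;> ring

theorem cos_four_mul (x : ℝ) : cos (4 * x) = 8 * cos x ^ 4 - 8 * cos x ^ 2 + 1 := by
  rw [show 4 * x = 2 * (2 * x) by ring, cos_two_mul, cos_two_mul]
  ring

theorem sin_four_mul (x : ℝ) : sin (4 * x) = 4 * sin x * cos x * (2 * cos x ^ 2 - 1) := by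
  rw [show 4 * x = 2 * (2 * x) by ring, sin_two_mul, sin_two_mul, cos_two_mul]
  ring

theorem inner_dir_pt (φ θ : ℝ) :
    inner ℝ (dir φ) (pt θ) = supp θ * cos (φ - θ) + suppDeriv θ * sin (φ - θ) := by
  rw [inner_eq, cos_sub, sin_sub]
  simp only [dir_zero, dir_one, pt_zero, pt_one]
  ring

theorem inner_dir_pt_self (θ : ℝ) : inner ℝ (dir θ) (pt θ) = supp θ := by
  simp [inner_dir_pt]

theorem inner_dir_dir (φ θ : ℝ) : inner ℝ (dir φ) (dir θ) = cos (φ - θ) := by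
  rw [inner_eq, cos_sub]
  rfl

/-- Both sides vanish to second order at `φ = θ`, so `1 - cos (φ - θ)` factors out. Bounding the
cofactor from below puts `pt θ` in the body and makes its normal unique; bounding it from above
makes the touching point of each supporting line unique. -/
theorem supp_sub_inner (φ θ : ℝ) :
    supp φ - inner ℝ (dir φ) (pt θ) = (1 - cos (φ - θ)) *
      (1 - cos (4 * θ) * (8 * cos (φ - θ) ^ 3 + 8 * cos (φ - θ) ^ 2 - 1) / 40
        + sin (4 * θ) * sin (φ - θ) * (2 * cos (φ - θ) ^ 2 + 2 * cos (φ - θ) + 1) / 10) := by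
  rw [inner_dir_pt]
  have h : cos (4 * φ) = cos (4 * θ) * cos (4 * (φ - θ)) - sin (4 * θ) * sin (4 * (φ - θ)) := by
    rw [← cos_add]
    congr 1
    ring
  unfold supp suppDeriv
  rw [h, cos_four_mul (φ - θ), sin_four_mul (φ - θ)]
  ring

theorem gap_factor_bounds (φ θ : ℝ) :
    1 / 8 ≤ 1 - cos (4 * θ) * (8 * cos (φ - θ) ^ 3 + 8 * cos (φ - θ) ^ 2 - 1) / 40
        + sin (4 * θ) * sin (φ - θ) * (2 * cos (φ - θ) ^ 2 + 2 * cos (φ - θ) + 1) / 10 ∧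
    1 - cos (4 * θ) * (8 * cos (φ - θ) ^ 3 + 8 * cos (φ - θ) ^ 2 - 1) / 40
        + sin (4 * θ) * sin (φ - θ) * (2 * cos (φ - θ) ^ 2 + 2 * cos (φ - θ) + 1) / 10 ≤ 2 := by
  have hx1 := cos_le_one (φ - θ)
  have hx2 := neg_one_le_cos (φ - θ)
  set x := cos (φ - θ)
  have hA : |8 * x ^ 3 + 8 * x ^ 2 - 1| ≤ 15 := by
    rw [abs_le]
    constructor
    · nlinarith [mul_nonneg (sq_nonneg x) (by linarith : 0 ≤ x + 1)]
    · nlinarith [mul_nonneg (by linarith : 0 ≤ 1 - x) (sq_nonneg (x + 1)), sq_nonneg x,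
        mul_nonneg (by linarith : 0 ≤ 1 - x) (sq_nonneg x)]
  have hB : |2 * x ^ 2 + 2 * x + 1| ≤ 5 := by
    rw [abs_le]
    constructor
    · nlinarith [sq_nonneg x]
    · nlinarith [mul_nonneg (by linarith : 0 ≤ 1 - x) (by linarith : 0 ≤ x + 1)]
  have h1 : |cos (4 * θ) * (8 * x ^ 3 + 8 * x ^ 2 - 1)| ≤ 1 * 15 := by
    rw [abs_mul]
    exact mul_le_mul (abs_cos_le_one _) hA (abs_nonneg _) zero_le_one
  have h2 : |sin (4 * θ) * sin (φ - θ) * (2 * x ^ 2 + 2 * x + 1)| ≤ 1 * 1 * 5 := by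
    rw [abs_mul, abs_mul]
    exact mul_le_mul (mul_le_mul (abs_sin_le_one _) (abs_sin_le_one _) (abs_nonneg _) zero_le_one)
      hB (abs_nonneg _) (by norm_num)
  rw [abs_le] at h1 h2
  constructor <;> linarith [h1.1, h1.2, h2.1, h2.2]

theorem supp_sub_inner_ge (φ θ : ℝ) :
    (1 - cos (φ - θ)) / 8 ≤ supp φ - inner ℝ (dir φ) (pt θ) := by
  rw [supp_sub_inner]
  nlinarith [(gap_factor_bounds φ θ).1, cos_le_one (φ - θ)]

theorem supp_sub_inner_le (φ θ : ℝ) :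
    supp φ - inner ℝ (dir φ) (pt θ) ≤ 2 * (1 - cos (φ - θ)) := by
  rw [supp_sub_inner]
  nlinarith [(gap_factor_bounds φ θ).2, cos_le_one (φ - θ)]

theorem pt_mem (θ : ℝ) : pt θ ∈ momentumBody := fun φ => by
  linarith [supp_sub_inner_ge φ θ, cos_le_one (φ - θ)]

theorem dir_eq_of_pt_eq {θ φ : ℝ} (h : pt θ = pt φ) : dir θ = dir φ := by
  have h1 := supp_sub_inner_ge φ θ
  rw [h, inner_dir_pt_self] at h1
  refine ((inner_eq_one_iff_of_norm_eq_one (𝕜 := ℝ) (norm_dir φ) (norm_dir θ)).1 ?_).symm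
  rw [inner_dir_dir]
  linarith [cos_le_one (φ - θ)]

/-- The supporting line with outer normal `dir θ` meets the body in `pt θ` only. -/
theorem eq_pt_of_inner_eq {x : Plane} (hx : x ∈ momentumBody) {θ : ℝ}
    (h : inner ℝ (dir θ) x = supp θ) : x = pt θ := by
  have hcs := cos_sq_add_sin_sq θ
  -- `κ` is the offset of `x` from `pt θ` along the supporting line.
  set κ := det (dir θ) x - suppDeriv θ with hκ
  have hx0 : x 0 = pt θ 0 - κ * sin θ := by
    rw [hκ]
    simp only [inner_eq, det, dir_zero, dir_one, pt_zero] at h ⊢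
    linear_combination cos θ * h - x 0 * hcs
  have hx1 : x 1 = pt θ 1 + κ * cos θ := by
    rw [hκ]
    simp only [inner_eq, det, dir_zero, dir_one, pt_one] at h ⊢
    linear_combination sin θ * h - x 1 * hcs
  have hδ : ∀ δ, κ * sin δ ≤ 2 * (1 - cos δ) := by
    intro δ
    have h1 := hx (θ + δ)
    have h2 := supp_sub_inner_le (θ + δ) θ
    have h3 : inner ℝ (dir (θ + δ)) x = inner ℝ (dir (θ + δ)) (pt θ) + κ * sin δ := by
      have : sin δ = sin (θ + δ) * cos θ - cos (θ + δ) * sin θ := by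
        rw [← sin_sub]
        congr 1
        ring
      rw [inner_eq, inner_eq, hx0, hx1, this]
      simp only [dir_zero, dir_one]
      ring
    rw [add_sub_cancel_left] at h2
    linarith
  have hκ0 : κ = 0 := by
    -- With `τ = tan (δ / 2)` the inequality reads `κ * τ ≤ 2 * τ ^ 2`, which fails for `τ` strictly
    -- between `0` and `κ / 2`; `τ = κ / 4` is the midpoint.
    have h1 := hδ (2 * arctan (κ / 4))
    rw [sin_two_mul, cos_two_mul] at h1
    have h2 := cos_arctan_pos (κ / 4)
    have h3 : sin (arctan (κ / 4)) = κ / 4 * cos (arctan (κ / 4)) := by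
      rw [← tan_mul_cos h2.ne', tan_arctan]
    have h4 := cos_sq_add_sin_sq (arctan (κ / 4))
    rw [h3] at h1 h4
    have h5 : κ ^ 2 * cos (arctan (κ / 4)) ^ 2 ≤ 0 := by linarith
    have h6 : 0 < cos (arctan (κ / 4)) ^ 2 := pow_pos h2 2
    nlinarith [sq_nonneg κ]
  refine plane_ext ?_ ?_
  · rw [hx0, hκ0]; ring
  · rw [hx1, hκ0]; ring

/-! ### Interior, boundary, strict convexity and compactness of the momentum body -/

theorem continuous_dir : Continuous dir := by
  unfold dir
  fun_prop

theorem continuous_supp : Continuous supp := by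
  unfold supp
  fun_prop

theorem exists_dir_Icc (θ : ℝ) : ∃ φ ∈ Set.Icc 0 (2 * π), dir φ = dir θ ∧ supp φ = supp θ := by
  refine ⟨toIcoMod two_pi_pos 0 θ, ?_, ?_⟩
  · have := toIcoMod_mem_Ico two_pi_pos 0 θ
    exact ⟨this.1, by linarith [this.2]⟩
  · have h : toIcoMod two_pi_pos 0 θ = θ - (toIcoDiv two_pi_pos 0 θ : ℤ) * (2 * π) := by
      rw [toIcoMod, zsmul_eq_mul]
    rw [h, supp, supp, cos_four_mul, cos_four_mul, cos_sub_int_mul_two_pi]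
    refine ⟨plane_ext ?_ ?_, rfl⟩
    · exact cos_sub_int_mul_two_pi _ _
    · exact sin_sub_int_mul_two_pi _ _

/-- By periodicity and compactness the gap has a positive minimum over all directions, and the ball
of that radius about `z` violates no constraint. -/
theorem mem_interior_of_inner_lt {z : Plane} (h : ∀ θ, inner ℝ (dir θ) z < supp θ) :
    z ∈ interior momentumBody := by
  have hc : Continuous fun θ => supp θ - inner ℝ (dir θ) z :=
    continuous_supp.sub (continuous_dir.inner continuous_const)
  obtain ⟨φ, -, hφ⟩ := (isCompact_Icc (a := (0 : ℝ)) (b := 2 * π)).exists_isMinOn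
    ⟨0, by simp [pi_pos.le]⟩ hc.continuousOn
  have hm : 0 < supp φ - inner ℝ (dir φ) z := sub_pos.2 (h φ)
  rw [mem_interior_iff_mem_nhds]
  refine Filter.mem_of_superset (Metric.ball_mem_nhds z hm) fun y hy θ => ?_
  obtain ⟨θ', hθ', h1, h2⟩ := exists_dir_Icc θ
  have h3 := isMinOn_iff.1 hφ θ' hθ'
  rw [h1, h2] at h3
  have h4 := real_inner_le_norm (dir θ) (y - z)
  rw [norm_dir, one_mul, inner_sub_right] at h4
  rw [Metric.mem_ball, dist_eq_norm] at hy
  linarith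

theorem inner_lt_of_mem_interior {z : Plane} (h : z ∈ interior momentumBody) (θ : ℝ) :
    inner ℝ (dir θ) z < supp θ := by
  rw [mem_interior_iff_mem_nhds, Metric.mem_nhds_iff] at h
  obtain ⟨ε, hε, h⟩ := h
  have h1 : z + (ε / 2) • dir θ ∈ Metric.ball z ε := by
    rw [Metric.mem_ball, dist_eq_norm, add_sub_cancel_left, norm_smul, norm_dir, mul_one,
      Real.norm_of_nonneg (by positivity)]
    linarith
  have h2 := h h1 θ
  rw [inner_add_right, real_inner_smul_right, real_inner_self_eq_norm_sq, norm_dir] at h2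
  linarith

theorem isClosed_momentumBody : IsClosed momentumBody := by
  have : momentumBody = ⋂ θ, {x | inner ℝ (dir θ) x ≤ supp θ} := by
    ext x
    simp [momentumBody]
  rw [this]
  exact isClosed_iInter fun θ => isClosed_le (by fun_prop) continuous_const

theorem pt_mem_frontier (θ : ℝ) : pt θ ∈ frontier momentumBody := by
  rw [isClosed_momentumBody.frontier_eq]
  refine ⟨pt_mem θ, fun h => ?_⟩
  have := inner_lt_of_mem_interior h θ
  rw [inner_dir_pt_self] at this
  exact lt_irrefl _ this

theorem exists_eq_pt {x : Plane} (hx : x ∈ frontier momentumBody) : ∃ θ, x = pt θ := by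
  rw [isClosed_momentumBody.frontier_eq] at hx
  by_contra! hne
  refine hx.2 (mem_interior_of_inner_lt fun θ => lt_of_le_of_ne (hx.1 θ) fun h => ?_)
  exact hne θ (eq_pt_of_inner_eq hx.1 h)

theorem isOuterUnitNormal_pt (θ : ℝ) : IsOuterUnitNormal momentumBody (pt θ) (dir θ) :=
  ⟨pt_mem_frontier θ, norm_dir θ, fun _ hy => (inner_dir_pt_self θ).symm ▸ hy θ⟩

theorem IsOuterUnitNormal.exists_angle {x u : Plane} (h : IsOuterUnitNormal momentumBody x u) :
    ∃ θ, u = dir θ ∧ x = pt θ := by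
  obtain ⟨h1, h2, h3⟩ := h
  obtain ⟨θ, rfl⟩ := exists_dir h2
  rw [isClosed_momentumBody.frontier_eq] at h1
  refine ⟨θ, rfl, eq_pt_of_inner_eq h1.1 (le_antisymm (h1.1 θ) ?_)⟩
  rw [← inner_dir_pt_self θ]
  exact h3 _ (pt_mem θ)

theorem strictConvex_momentumBody : StrictConvex ℝ momentumBody := by
  intro x hx y hy hxy a b ha hb hab
  refine mem_interior_of_inner_lt fun θ => ?_
  rw [inner_add_right, real_inner_smul_right, real_inner_smul_right]
  have e : supp θ = a * supp θ + b * supp θ := by rw [← add_mul, hab, one_mul]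
  rcases (hx θ).lt_or_eq with h | h
  · nlinarith [hy θ, mul_lt_mul_of_pos_left h ha, mul_le_mul_of_nonneg_left (hy θ) hb.le]
  · rcases (hy θ).lt_or_eq with h' | h'
    · nlinarith [mul_lt_mul_of_pos_left h' hb]
    · exact absurd ((eq_pt_of_inner_eq hx h).trans (eq_pt_of_inner_eq hy h').symm) hxy

theorem zero_mem_interior : (0 : Plane) ∈ interior momentumBody :=
  mem_interior_of_inner_lt fun θ => by
    rw [inner_zero_right]
    linarith [supp_pos θ]

theorem isCompact_momentumBody : IsCompact momentumBody := by
  refine Metric.isCompact_of_isClosed_isBounded isClosed_momentumBody ?_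
  refine (Metric.isBounded_closedBall (x := (0 : Plane)) (r := 2)).subset fun x hx => ?_
  rw [mem_closedBall_zero_iff]
  by_contra! hn
  have hn0 : 0 < ‖x‖ := by linarith
  obtain ⟨θ, hθ⟩ := exists_dir (u := ‖x‖⁻¹ • x) (by
    rw [norm_smul, norm_inv, norm_norm, inv_mul_cancel₀ hn0.ne'])
  have h1 := hx θ
  rw [← hθ, real_inner_smul_left, real_inner_self_eq_norm_sq, sq, ← mul_assoc,
    inv_mul_cancel₀ hn0.ne', one_mul] at h1
  have := cos_le_one (4 * θ)
  unfold supp at h1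
  linarith

theorem smul_pt_mem_iff {s : ℝ} (hs : 0 ≤ s) (θ : ℝ) : s • pt θ ∈ momentumBody ↔ s ≤ 1 := by
  constructor
  · intro h
    have := h θ
    rw [real_inner_smul_right, inner_dir_pt_self] at this
    nlinarith [supp_pos θ]
  · intro h φ
    rw [real_inner_smul_right]
    have h1 := pt_mem θ φ
    have h2 := supp_pos φ
    nlinarith [mul_le_mul_of_nonneg_left h1 hs]

/-! ### Smoothness of the boundary of the momentum body -/

theorem hasDerivAt_supp (θ : ℝ) : HasDerivAt supp (suppDeriv θ) θ := by
  have h := ((((hasDerivAt_id' θ).const_mul 4).cos).div_const 40).const_add 1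
  refine h.congr_deriv ?_
  rw [suppDeriv]
  ring

theorem hasDerivAt_suppDeriv (θ : ℝ) : HasDerivAt suppDeriv (-(2 / 5) * cos (4 * θ)) θ := by
  have h := ((((hasDerivAt_id' θ).const_mul 4).sin).fun_neg).div_const 10
  refine h.congr_deriv ?_
  ring

/-- The radius of curvature of the momentum body. -/
noncomputable def curvRadius (θ : ℝ) : ℝ := 1 - 3 / 8 * cos (4 * θ)

theorem curvRadius_pos (θ : ℝ) : 0 < curvRadius θ := by
  have := cos_le_one (4 * θ)
  unfold curvRadius
  linarith

theorem hasDerivAt_pt (θ : ℝ) :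
    HasDerivAt pt (curvRadius θ • !₂[-sin θ, cos θ]) θ := by
  have h : HasDerivAt (fun θ => ![supp θ * cos θ - suppDeriv θ * sin θ,
      supp θ * sin θ + suppDeriv θ * cos θ])
      ![-(curvRadius θ * sin θ), curvRadius θ * cos θ] θ := by
    rw [hasDerivAt_pi, Fin.forall_fin_two]
    constructor
    · refine (((hasDerivAt_supp θ).fun_mul (hasDerivAt_cos θ)).fun_sub
        ((hasDerivAt_suppDeriv θ).fun_mul (hasDerivAt_sin θ))).congr_deriv ?_
      simp only [curvRadius, supp, Matrix.cons_val_zero]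
      ring
    · refine (((hasDerivAt_supp θ).fun_mul (hasDerivAt_sin θ)).fun_add
        ((hasDerivAt_suppDeriv θ).fun_mul (hasDerivAt_cos θ))).congr_deriv ?_
      simp only [curvRadius, supp, Matrix.cons_val_one, Matrix.cons_val_fin_one]
      ring
  refine ((PiLp.hasFDerivAt_toLp (𝕜 := ℝ) 2 _).comp_hasDerivAt θ h).congr_deriv ?_
  refine plane_ext ?_ ?_
  · simp
  · simp

theorem contDiff_pt : ContDiff ℝ 1 pt := by
  unfold pt supp suppDeriv
  rw [contDiff_euclidean]
  intro i
  fin_cases i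
  · simp
    fun_prop
  · simp
    fun_prop

/-- The Jacobian determinant at `(1, θ)` is `supp θ * curvRadius θ`, a product of positive numbers.
-/
theorem exists_equiv_hasFDerivAt_smul_pt (θ : ℝ) : ∃ L : (ℝ × ℝ) ≃L[ℝ] Plane,
    HasFDerivAt (fun z : ℝ × ℝ => z.1 • pt z.2) (L : (ℝ × ℝ) →L[ℝ] Plane) (1, θ) ∧
      L (1, 0) = pt θ := by
  set M : (ℝ × ℝ) →L[ℝ] Plane := (ContinuousLinearMap.fst ℝ ℝ ℝ).smulRight (pt θ) +
    (ContinuousLinearMap.snd ℝ ℝ ℝ).smulRight (curvRadius θ • !₂[-sin θ, cos θ]) with hM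
  have hMa : ∀ z, M z = z.1 • pt θ + z.2 • curvRadius θ • !₂[-sin θ, cos θ] := fun z => by
    simp [hM]
  have hinj : Function.Injective (M : (ℝ × ℝ) →ₗ[ℝ] Plane) := by
    rw [injective_iff_map_eq_zero]
    rintro ⟨a, b⟩ h
    rw [ContinuousLinearMap.coe_coe, hMa] at h
    have h0 := congrArg (fun v : Plane => v 0) h
    have h1 := congrArg (fun v : Plane => v 1) h
    simp at h0 h1
    have hcs := cos_sq_add_sin_sq θ
    have ha : a * supp θ = 0 := by
      linear_combination cos θ * h0 + sin θ * h1 - a * supp θ * hcs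
    have ha0 : a = 0 := (mul_eq_zero.1 ha).resolve_right (by linarith [supp_pos θ])
    subst ha0
    have hb : b * curvRadius θ = 0 := by
      linear_combination -sin θ * h0 + cos θ * h1 - b * curvRadius θ * hcs
    have hb0 : b = 0 := (mul_eq_zero.1 hb).resolve_right (curvRadius_pos θ).ne'
    rw [hb0]
    rfl
  refine ⟨(LinearMap.linearEquivOfInjective (M : (ℝ × ℝ) →ₗ[ℝ] Plane) hinj
    (by simp)).toContinuousLinearEquiv, ?_, ?_⟩
  · have h : HasFDerivAt (fun z : ℝ × ℝ => z.1 • pt z.2) M (1, θ) := by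
      have h1 : HasFDerivAt (fun z : ℝ × ℝ => pt z.2) _ ((1, θ) : ℝ × ℝ) :=
        HasFDerivAt.comp (g := pt) ((1, θ) : ℝ × ℝ) (hasDerivAt_pt θ).hasFDerivAt hasFDerivAt_snd
      refine (hasFDerivAt_fst.smul h1).congr_fderiv ?_
      ext z <;> simp [hMa]
    refine h.congr_fderiv ?_
    ext z <;> rfl
  · change M (1, 0) = _
    simp [hMa]

/-- By the inverse function theorem `(s, θ) ↦ s • pt θ` gives local `C¹` coordinates in which the
body is `s ≤ 1`, so `s - 1` is a defining function. Its derivative at the boundary point is `1` in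
the radial direction `L (1, 0)`. -/
theorem hasC1Boundary_momentumBody : HasC1Boundary momentumBody := by
  intro x hx
  obtain ⟨θ, rfl⟩ := exists_eq_pt hx
  obtain ⟨L, hL, hL1⟩ := exists_equiv_hasFDerivAt_smul_pt θ
  set F : ℝ × ℝ → Plane := fun z => z.1 • pt z.2 with hF
  have hcF : ContDiffAt ℝ 1 F (1, θ) :=
    (contDiff_fst.smul (contDiff_pt.comp contDiff_snd)).contDiffAt
  have hFa : F (1, θ) = pt θ := by simp [hF]
  set e := hcF.toOpenPartialHomeomorph F hL one_ne_zero with he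
  have heF : ∀ z, e z = F z := fun z => rfl
  have hsrc : ((1, θ) : ℝ × ℝ) ∈ e.source := hcF.mem_toOpenPartialHomeomorph_source hL one_ne_zero
  have htgt : pt θ ∈ e.target := by
    rw [← hFa, ← heF]
    exact e.map_source hsrc
  have hsymm : e.symm (pt θ) = (1, θ) := by
    rw [← hFa, ← heF, e.left_inv hsrc]
  have hinv : ContDiffAt ℝ 1 e.symm (pt θ) := by
    rw [← hFa]
    exact hcF.to_localInverse hL one_ne_zero
  have hder : HasFDerivAt e.symm (L.symm : Plane →L[ℝ] ℝ × ℝ) (pt θ) := by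
    refine e.hasFDerivAt_symm htgt ?_
    rw [hsymm]
    exact hL
  obtain ⟨V, hV, hVc⟩ := hinv.contDiffOn le_rfl (by simp)
  have hW : {y | 0 < (e.symm y).1} ∈ nhds (pt θ) := by
    have : Filter.Tendsto (fun y => (e.symm y).1) (nhds (pt θ)) (nhds 1) := by
      have := (continuous_fst.continuousAt.comp hinv.continuousAt).tendsto
      rwa [Function.comp_apply, hsymm] at this
    exact this.eventually (lt_mem_nhds one_pos)
  obtain ⟨U, hU, hUo, hUx⟩ := mem_nhds_iff.1
    (Filter.inter_mem (Filter.inter_mem hV hW) (e.open_target.mem_nhds htgt))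
  refine ⟨U, hUo, hUx, fun y => (e.symm y).1 - 1, ?_, ?_, ?_⟩
  · exact ((contDiff_fst.comp_contDiffOn (hVc.mono fun y hy => (hU hy).1.1))).sub contDiffOn_const
  · intro h
    have hd : HasFDerivAt (fun y => (e.symm y).1 - 1)
        ((ContinuousLinearMap.fst ℝ ℝ ℝ).comp (L.symm : Plane →L[ℝ] ℝ × ℝ)) (pt θ) :=
      ((hasFDerivAt_fst.comp (pt θ) hder)).sub_const 1
    rw [hd.fderiv] at h
    have h1 := congrArg (fun A : Plane →L[ℝ] ℝ => A (L (1, 0))) h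
    simp at h1
  · intro y hy
    obtain ⟨⟨-, hpos⟩, ht⟩ := hU hy
    have hy' : (e.symm y).1 • pt (e.symm y).2 = y := e.right_inv ht
    rw [sub_nonpos, ← smul_pt_mem_iff (le_of_lt hpos) (e.symm y).2, hy']

theorem isSmoothStrictlyConvexBody_momentumBody : IsSmoothStrictlyConvexBody momentumBody where
  isCompact := isCompact_momentumBody
  strictConvex := strictConvex_momentumBody
  interior_nonempty := ⟨0, zero_mem_interior⟩
  hasC1Boundary := hasC1Boundary_momentumBody

theorem neg_mem_momentumBody {x : Plane} (hx : x ∈ momentumBody) : -x ∈ momentumBody := by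
  intro θ
  have := hx (θ + π)
  rwa [dir_add_pi, supp_add_pi, inner_neg_left, ← inner_neg_right] at this

/-! ### The reflection law -/

theorem cos_four_mul_of_sin_sq {a : ℝ} (hs : sin a ^ 2 = 1 / 6) : cos (4 * a) = -1 / 9 := by
  rw [cos_four_mul]
  have := cos_sq_add_sin_sq a
  rw [show cos a ^ 4 = (cos a ^ 2) ^ 2 by ring, show cos a ^ 2 = 5 / 6 by linarith]
  norm_num

theorem sin_four_mul_of_sin_sq {a : ℝ} (hs : sin a ^ 2 = 1 / 6) :
    sin (4 * a) = 8 / 3 * sin a * cos a := by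
  have := cos_sq_add_sin_sq a
  rw [sin_four_mul, show cos a ^ 2 = 5 / 6 by linarith]
  ring

theorem det_dir_pt_eq (φ θ : ℝ) :
    det (dir φ) (pt θ) = suppDeriv θ * cos (φ - θ) - supp θ * sin (φ - θ) := by
  rw [cos_sub, sin_sub]
  simp only [det, dir_zero, dir_one, pt_zero, pt_one]
  ring

/-- The coefficient of `sin (4 * θ)` is `-(4 cos (4 a) cos a + sin (4 a) sin a) / 40`, which the
choice of `a` annihilates. What remains is odd in `a`, and it is also the signed distance of the
dual line from the origin. -/
theorem det_dir_pt {a : ℝ} (hs : sin a ^ 2 = 1 / 6) (θ : ℝ) :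
    det (dir θ) (pt (θ - a)) = -(sin a * (1 - 9 / 40 * cos (4 * θ))) := by
  have hcs := cos_sq_add_sin_sq a
  rw [det_dir_pt_eq, sub_sub_cancel, supp, suppDeriv, mul_sub, sin_sub, cos_sub, cos_four_mul_of_sin_sq hs,
    sin_four_mul_of_sin_sq hs]
  linear_combination (cos (4 * θ) * sin a * (4 / 15)) * (hcs - hs)
    + (-sin (4 * θ) * cos a / 15) * hs

theorem inner_dir_pt_sub_pos {a : ℝ} (hs : sin a ^ 2 = 1 / 6) (hc : 0 < cos a) (θ : ℝ) :
    0 < inner ℝ (dir θ) (pt (θ - a)) := by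
  have hcs := cos_sq_add_sin_sq a
  rw [inner_dir_pt, sub_sub_cancel]
  have h1 := supp_pos (θ - a)
  have h2 : |suppDeriv (θ - a)| ≤ 1 / 10 := by
    rw [suppDeriv, abs_div, abs_neg, abs_of_pos (by norm_num : (0 : ℝ) < 10)]
    linarith [abs_sin_le_one (4 * (θ - a))]
  have h3 : |sin a| ≤ cos a := abs_le_of_sq_le_sq (by linarith) hc.le
  have h4 : |suppDeriv (θ - a) * sin a| ≤ 1 / 10 * cos a := by
    rw [abs_mul]
    exact mul_le_mul h2 h3 (abs_nonneg _) (by norm_num)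
  nlinarith [(abs_le.1 h4).1]

/-- This is the reflection law at `dir θ`. Components normal to `dir θ` cancel because `det_dir_pt`
is odd in `a`; positivity of `k` gives the momentum jump its outward direction. -/
theorem pt_add_pt {a : ℝ} (hs : sin a ^ 2 = 1 / 6) (hc : 0 < cos a) (θ : ℝ) :
    ∃ k : ℝ, 0 < k ∧ pt (θ + a) + pt (θ - a) = k • dir θ := by
  have hs' : sin (-a) ^ 2 = 1 / 6 := by rw [sin_neg, neg_sq, hs]
  have hc' : 0 < cos (-a) := by rwa [cos_neg]
  have h1 := det_dir_pt hs θ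
  have h2 := det_dir_pt hs' θ
  have h3 := inner_dir_pt_sub_pos hs hc θ
  have h4 := inner_dir_pt_sub_pos hs' hc' θ
  rw [sub_neg_eq_add] at h2 h4
  rw [sin_neg] at h2
  refine ⟨_, add_pos h4 h3, ?_⟩
  have hcs := cos_sq_add_sin_sq θ
  simp only [inner_eq, det, dir_zero, dir_one] at h1 h2 ⊢
  refine plane_ext ?_ ?_
  · simp only [PiLp.add_apply, PiLp.smul_apply, smul_eq_mul, dir_zero]
    linear_combination -(pt (θ + a) 0 + pt (θ - a) 0) * hcs - sin θ * (h1 + h2)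
  · simp only [PiLp.add_apply, PiLp.smul_apply, smul_eq_mul, dir_one]
    linear_combination -(pt (θ + a) 1 + pt (θ - a) 1) * hcs + cos θ * (h1 + h2)

theorem det_dir_sub_dir (θ a : ℝ) : det (dir (θ - a)) (dir θ) = sin a := by
  have h : sin a = sin (θ - (θ - a)) := by rw [sub_sub_cancel]
  rw [h, sin_sub]
  simp only [det, dir_zero, dir_one]
  ring

theorem det_sub_smul_dir (x : Plane) (θ t : ℝ) :
    det (dir θ) (x - t • dir θ) = det (dir θ) x := by
  simp only [det, dir_zero, dir_one, PiLp.sub_apply, PiLp.smul_apply, smul_eq_mul]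
  ring

/-- Two boundary points of a strictly convex set on the same side of a third one, on a line
through it, coincide. -/
theorem eq_of_mem_frontier_of_ray {T : Set Plane} (hT : StrictConvex ℝ T) (hTc : IsClosed T)
    {x v : Plane} {s t : ℝ} (hs : 0 < s) (ht : 0 < t) (hv : v ≠ 0) (hx : x ∈ T)
    (h1 : x + s • v ∈ frontier T) (h2 : x + t • v ∈ frontier T) : s = t := by
  have key : ∀ s t : ℝ, 0 < s → s < t → x + s • v ∈ frontier T → x + t • v ∈ frontier T →
      False := by
    intro s t hs hst h1 h2
    have ht : 0 < t := hs.trans hst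
    have hne : x ≠ x + t • v := by
      simp [ht.ne', hv]
    have h3 := hT hx (hTc.frontier_subset h2) hne (sub_pos.2 ((div_lt_one ht).2 hst))
      (div_pos hs ht) (sub_add_cancel _ _)
    have h4 : (1 - s / t) • x + (s / t) • (x + t • v) = x + s • v := by
      rw [smul_add, smul_smul, div_mul_cancel₀ _ ht.ne', sub_smul, one_smul]
      abel
    rw [h4] at h3
    exact h1.2 h3
  rcases lt_trichotomy s t with h | h | h
  · exact (key s t hs h h1 h2).elim
  · exact h
  · exact (key t s ht h h2 h1).elim

theorem mem_frontier_unit_disc {x : Plane} :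
    x ∈ frontier (Metric.closedBall (0 : Plane) 1) ↔ ‖x‖ = 1 := by
  rw [frontier_closedBall _ one_ne_zero]
  simp

/-- The incoming chord makes an angle `a` of either sign with the normal, and `pt_add_pt` exhibits a
boundary point of `T` on the ray followed by the momentum. Strict convexity leaves no other, so the
outgoing chord makes the angle `-a`. -/
theorem tangent_step {r : ℝ} (hr : 0 < r) (hr2 : r ^ 2 = 1 / 6) {q p : ℤ → Plane}
    (h : IsBilliardTrajectory (Metric.closedBall 0 1) momentumBody q p) (i : ℤ)
    (ht : IsTangentLine (Metric.closedBall 0 r) (q i) (q (i + 1))) :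
    IsTangentLine (Metric.closedBall 0 r) (q (i + 1)) (q (i + 1 + 1)) := by
  obtain ⟨u, hu, t, ht0, hq⟩ := h.q_step i
  obtain ⟨ψ, rfl, hp⟩ := hu.exists_angle
  obtain ⟨θ, hθ⟩ := exists_dir (mem_frontier_unit_disc.1 (h.q_mem (i + 1)))
  rw [isTangentLine_closedBall_iff hr.le ht0 hq, ← det_sub_smul_dir _ _ t, ← hq, hθ, hr2] at ht
  obtain ⟨a, ha⟩ : ∃ a, a = ψ - θ - π := ⟨_, rfl⟩
  have hψ : ψ = θ + a + π := by rw [ha]; ring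
  have hs : sin a ^ 2 = 1 / 6 := by
    rw [← ht, hψ, dir_add_pi, ← sub_neg_eq_add θ a]
    have := det_dir_sub_dir θ (-a)
    rw [sin_neg] at this
    rw [← neg_sq, ← this]
    simp only [det, PiLp.neg_apply]
    ring
  -- The chord ends on the unit circle, so `t ^ 2 = 2 * t * cos a` with `t > 0`.
  have hc : 0 < cos a := by
    have h1 : ‖q i‖ ^ 2 = 1 := by
      rw [mem_frontier_unit_disc.1 (h.q_mem i), one_pow]
    have h2 : q i = dir θ + t • dir ψ := by rw [← hθ, hq, sub_add_cancel]
    rw [h2, norm_add_sq_real, norm_smul, norm_dir, norm_dir, real_inner_smul_right, inner_dir_dir,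
      Real.norm_of_nonneg ht0.le] at h1
    have h3 : cos (θ - ψ) = -cos a := by
      rw [hψ, show θ - (θ + a + π) = -(a + π) by ring, cos_neg, cos_add_pi]
    rw [h3] at h1
    nlinarith
  obtain ⟨k, hk, hkp⟩ := pt_add_pt hs hc θ
  obtain ⟨n, hn, s, hs0, hps⟩ := h.p_step i
  have hnθ : n = dir θ := hn.eq_of_closedBall.trans hθ
  rw [hψ, pt_add_pi] at hp
  have hQ : p i + k • dir θ = pt (θ - a) := by
    rw [hp, ← hkp]
    abel
  rw [hnθ] at hps
  have hsk : s = k := by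
    refine eq_of_mem_frontier_of_ray strictConvex_momentumBody isClosed_momentumBody hs0 hk
      (v := dir θ) ?_ (isClosed_momentumBody.frontier_subset (h.p_mem i)) ?_ ?_
    · rw [← norm_ne_zero_iff, norm_dir]
      exact one_ne_zero
    · rw [← hps]
      exact h.p_mem _
    · rw [hQ]
      exact pt_mem_frontier _
  obtain ⟨w, hw, t', ht', hq'⟩ := h.q_step (i + 1)
  obtain ⟨φ, rfl, hpφ⟩ := hw.exists_angle
  have hφ : dir φ = dir (θ - a) := dir_eq_of_pt_eq (by rw [← hpφ, hps, hsk, hQ])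
  rw [isTangentLine_closedBall_iff hr.le ht' hq', hφ, hθ, det_dir_sub_dir, hs, hr2]

theorem isConvexCaustic_closedBall {r : ℝ} (hr : 0 < r) (hr2 : r ^ 2 = 1 / 6) :
    IsConvexCaustic (Metric.closedBall 0 1) momentumBody (Metric.closedBall 0 r) where
  nonempty := ⟨0, by simp [hr.le]⟩
  isCompact := isCompact_closedBall _ _
  convex := convex_closedBall _ _
  subset := Metric.closedBall_subset_closedBall (by nlinarith)
  stays_tangent := by
    intro q p h i hi j hij
    induction j, hij using Int.leInduction with
    | base => exact hi
    | succ j _ ih => exact tangent_step hr hr2 h j ih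

/-! ### The dual trajectories have no convex caustic -/

/-- Each chord tangent to the caustic advances the bounce angle by `π - 2 * a`, as in the Euclidean
disc; only the momenta feel the shape of `T`. -/
theorem isBilliardTrajectory_dir {a : ℝ} (hs : sin a ^ 2 = 1 / 6) (hc : 0 < cos a) (θ : ℝ) :
    IsBilliardTrajectory (Metric.closedBall 0 1) momentumBody
      (fun i => dir (θ + i * (π - 2 * a))) (fun i => pt (θ + i * (π - 2 * a) - a)) where
  q_mem i := mem_frontier_unit_disc.2 (norm_dir _)
  p_mem i := pt_mem_frontier _
  q_step i := by
    refine ⟨_, isOuterUnitNormal_pt _, 2 * cos a, by linarith, ?_⟩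
    set φ := θ + i * (π - 2 * a) with hφ
    have h1 : θ + ((i + 1 : ℤ) : ℝ) * (π - 2 * a) = φ - a - a + π := by
      rw [hφ]
      push_cast
      ring
    have h2 : dir φ = dir (φ - a + a) := by rw [sub_add_cancel]
    rw [h1, dir_add_pi, h2]
    refine plane_ext ?_ ?_
    · simp only [PiLp.neg_apply, PiLp.sub_apply, PiLp.smul_apply, smul_eq_mul, dir_zero]
      rw [cos_add, cos_sub (φ - a)]
      ring
    · simp only [PiLp.neg_apply, PiLp.sub_apply, PiLp.smul_apply, smul_eq_mul, dir_one]
      rw [sin_add, sin_sub (φ - a)]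
      ring
  p_step i := by
    set φ := θ + ((i + 1 : ℤ) : ℝ) * (π - 2 * a) with hφ
    obtain ⟨k, hk, h⟩ := pt_add_pt hs hc φ
    refine ⟨dir φ, isOuterUnitNormal_closedBall (norm_dir _), k, hk, ?_⟩
    have h1 : φ + a = θ + i * (π - 2 * a) - a + π := by
      rw [hφ]
      push_cast
      ring
    rw [← h, h1, pt_add_pi]
    abel

theorem isTangentTrajectory_dir {a r : ℝ} (hs : sin a ^ 2 = 1 / 6) (hc : 0 < cos a)
    (hr : 0 < r) (hr2 : r ^ 2 = 1 / 6) (θ : ℝ) :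
    IsTangentTrajectory (Metric.closedBall 0 r) (fun i : ℤ => dir (θ + i * (π - 2 * a))) := by
  intro i
  obtain ⟨u, hu, t, ht, hq⟩ := (isBilliardTrajectory_dir hs hc θ).q_step i
  obtain ⟨φ, rfl, hpφ⟩ := hu.exists_angle
  rw [isTangentLine_closedBall_iff hr.le ht hq, ← dir_eq_of_pt_eq hpφ, det_dir_sub_dir, hs, hr2]

/-- A set touched by the lines of the dual trajectories through `dir θ` and `-dir θ` has the
width prescribed by these lines in the direction normal to `dir θ`. -/
theorem strip_of_areDualCaustics {a r : ℝ} (hs : sin a ^ 2 = 1 / 6) (hs0 : 0 < sin a)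
    (hc : 0 < cos a) (hr : 0 < r) (hr2 : r ^ 2 = 1 / 6) {C' : Set Plane}
    (h : AreDualCaustics (Metric.closedBall 0 1) momentumBody (Metric.closedBall 0 r) C')
    (θ : ℝ) :
    (∃ y ∈ C', det (dir θ) y = -(sin a * (1 - 9 / 40 * cos (4 * θ)))) ∧
      ∀ y ∈ C', |det (dir θ) y| ≤ sin a * (1 - 9 / 40 * cos (4 * θ)) := by
  -- For a single line, tangency does not tell on which side `C'` lies; the two cases are kept until
  -- the opposite line is available.
  have main : ∀ θ, (∃ y ∈ C', det (dir θ) y = -(sin a * (1 - 9 / 40 * cos (4 * θ)))) ∧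
      ((∀ y ∈ C', -(sin a * (1 - 9 / 40 * cos (4 * θ))) ≤ det (dir θ) y) ∨
        ∀ y ∈ C', det (dir θ) y ≤ -(sin a * (1 - 9 / 40 * cos (4 * θ)))) := by
    intro θ
    -- The dual segment from index `-1` to index `0` is the one produced by the bounce at `dir θ`.
    have hT := (h _ _ (isBilliardTrajectory_dir hs hc θ)).1
      (isTangentTrajectory_dir hs hc hr hr2 θ) (-1)
    obtain ⟨k, hk, hkp⟩ := pt_add_pt hs hc θ
    have e1 : θ + ((-1 + 1 : ℤ) : ℝ) * (π - 2 * a) - a = θ - a := by simp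
    have e2 : θ + a = θ + ((-1 : ℤ) : ℝ) * (π - 2 * a) - a + π := by
      push_cast
      ring
    rw [e2, pt_add_pi] at hkp
    have e3 : pt (θ - a) - pt (θ + ((-1 : ℤ) : ℝ) * (π - 2 * a) - a) = k • dir θ := by
      rw [← hkp]
      abel
    have e4 : pt (θ + ((-1 : ℤ) : ℝ) * (π - 2 * a) - a) = pt (θ - a) - k • dir θ := by
      rw [← e3]
      abel
    simp only [IsTangentLine, e1, e3] at hT
    rw [e4] at hT
    have e5 : ∀ t : ℝ, det (dir θ) (pt (θ - a) - k • dir θ + t • k • dir θ) =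
        det (dir θ) (pt (θ - a)) := by
      intro t
      simp only [det, dir_zero, dir_one, PiLp.add_apply, PiLp.sub_apply, PiLp.smul_apply,
        smul_eq_mul]
      ring
    have e6 : ∀ y : Plane, det (k • dir θ) (y - (pt (θ - a) - k • dir θ)) =
        k * (det (dir θ) y - det (dir θ) (pt (θ - a))) := by
      intro y
      simp only [det, dir_zero, dir_one, PiLp.sub_apply, PiLp.smul_apply, smul_eq_mul]
      ring
    rw [← det_dir_pt hs θ]
    rcases hT with ⟨⟨t, ht⟩, hT⟩ | ⟨⟨t, ht⟩, hT⟩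
    · refine ⟨⟨_, ht, e5 t⟩, Or.inl fun y hy => ?_⟩
      have := hT y hy
      rw [e6] at this
      exact sub_nonneg.1 (nonneg_of_mul_nonneg_right this hk)
    · refine ⟨⟨_, ht, ?_⟩, Or.inr fun y hy => ?_⟩
      · rw [smul_neg, ← neg_smul]
        exact e5 _
      · have := hT y hy
        have e7 : ∀ v w : Plane, det (-v) w = -det v w := fun v w => by
          simp only [det, PiLp.neg_apply]
          ring
        rw [e7, e6, ← mul_neg] at this
        linarith [nonneg_of_mul_nonneg_right this hk]
  obtain ⟨hy, hside⟩ := main θ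
  -- By symmetry the bounce at `-dir θ` gives the mirror line. Both lines are touched and they are
  -- distinct, so `C'` must lie between them.
  obtain ⟨⟨z, hz, hzd⟩, hside'⟩ := main (θ + π)
  refine ⟨hy, fun y hyC => ?_⟩
  obtain ⟨x, hx, hxd⟩ := hy
  have e : cos (4 * (θ + π)) = cos (4 * θ) := by
    have := supp_add_pi θ
    unfold supp at this
    linarith
  have en : ∀ y, det (dir (θ + π)) y = -det (dir θ) y := fun y => by
    rw [dir_add_pi]
    simp only [det, PiLp.neg_apply]
    ring
  rw [e, en] at hzd
  simp only [e, en] at hside'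
  have hH : 0 < sin a * (1 - 9 / 40 * cos (4 * θ)) :=
    mul_pos hs0 (by linarith [cos_le_one (4 * θ)])
  rw [abs_le]
  constructor
  · rcases hside with hl | hl
    · exact hl y hyC
    · linarith [hl z hz]
  · rcases hside' with hl | hl
    · linarith [hl y hyC]
    · linarith [hl x hx]

theorem not_areDualCaustics {r : ℝ} (hr : 0 < r) (hr2 : r ^ 2 = 1 / 6) (C' : Set Plane) :
    ¬AreDualCaustics (Metric.closedBall 0 1) momentumBody (Metric.closedBall 0 r) C' := by
  intro h
  have hr1 : r < 1 := by nlinarith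
  have hsr : sin (arcsin r) = r := sin_arcsin (by linarith) hr1.le
  have hs : sin (arcsin r) ^ 2 = 1 / 6 := by rw [hsr, hr2]
  have hc : 0 < cos (arcsin r) := by
    rw [cos_arcsin, hr2]
    exact sqrt_pos.2 (by norm_num)
  have key := strip_of_areDualCaustics hs (hsr.symm ▸ hr) hc hr hr2 h
  rw [hsr] at key
  -- The strips for `0` and `π / 2` confine `C'` to a square of half-side `31/40 * r`, whose extent
  -- in the diagonal direction is `31/40 * √2 * r`. The line for `π / 4` demands a point at distance
  -- `49/40 * r`, and `31 * √2 < 49`.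
  obtain ⟨y, hy, hyd⟩ := (key (π / 4)).1
  have h0 := (key 0).2 y hy
  have h1 := (key (π / 2)).2 y hy
  rw [mul_div_cancel₀ _ (four_ne_zero' ℝ), cos_pi] at hyd
  rw [show 4 * (π / 2) = 2 * π by ring, cos_two_pi] at h1
  simp only [det, dir_zero, dir_one, cos_zero, sin_zero, cos_pi_div_two, sin_pi_div_two, mul_zero,
    cos_pi_div_four, sin_pi_div_four] at hyd h0 h1
  rw [abs_le] at h0 h1
  have h2 : √2 < 3 / 2 := by
    rw [sqrt_lt' (by norm_num)]
    norm_num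
  have h3 : 0 < √2 := by positivity
  nlinarith [h0.1, h0.2, h1.1, h1.2]

end MinkowskiBilliard

theorem theorem1p5 :
    ∃ K T C : Set MinkowskiBilliard.Plane,
      MinkowskiBilliard.IsSymmetricBilliardConfiguration K T ∧
      MinkowskiBilliard.IsConvexCaustic K T C ∧
      MinkowskiBilliard.IsSmoothStrictlyConvexBody C ∧
      C ⊆ interior K ∧
      ¬ ∃ C' : Set MinkowskiBilliard.Plane,
        MinkowskiBilliard.IsConvexCaustic T K C' ∧
        MinkowskiBilliard.AreDualCaustics K T C C' := by
  have hr : 0 < √(1 / 6 : ℝ) := Real.sqrt_pos.2 (by norm_num)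
  have hr2 : √(1 / 6 : ℝ) ^ 2 = 1 / 6 := Real.sq_sqrt (by norm_num)
  refine ⟨Metric.closedBall 0 1, MinkowskiBilliard.momentumBody, Metric.closedBall 0 √(1 / 6),
    ⟨MinkowskiBilliard.isSmoothStrictlyConvexBody_closedBall one_pos,
      MinkowskiBilliard.isSmoothStrictlyConvexBody_momentumBody, fun x hx => by simpa using hx,
      fun x hx => MinkowskiBilliard.neg_mem_momentumBody hx⟩,
    MinkowskiBilliard.isConvexCaustic_closedBall hr hr2,
    MinkowskiBilliard.isSmoothStrictlyConvexBody_closedBall hr, ?_, ?_⟩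
  · rw [interior_closedBall _ one_ne_zero]
    exact Metric.closedBall_subset_ball (by nlinarith)
  · rintro ⟨C', -, h⟩
    exact MinkowskiBilliard.not_areDualCaustics hr hr2 C' h
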